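/- All Banach spaces are real. A norm $\|\cdot\|$ on a space $E$ is called octahedral if for every finite-dimensional subspace $F\subseteq E$ and every $\varepsilon>0$ there is $y\in E$ with $\|y\|=1$ such that $\|x+y\|\ge(1-\varepsilon)(\|x\|+\|y\|)$ for all $x\in F$. A Banach space $X$ has the separable complementation property if every separable subspace $Y\subseteq X$ is contained in a separable subspace $Z\subseteq X$ that is complemented in $X$ (that is, the range of a bounded linear projection on $X$). $X$ is weakly countably determined if there is a sequence $(K_n)$ of weak$^*$-compact subsets of $X^{**}$ such that for all $x\in X$ and $u\in X^{**}\setminus X$ there is $n$ with $x\in K_n$ and $u\notin K_n$. Let $X$ be a Banach space. 1. If $X$ has the separable complementation property and contains a subspace isomorphic to $\ell_1$, then there is an equivalent norm on $X$ whose bidual norm on $X^{**}$ is octahedral. 2. If $X$ is weakly countably determined, then $X$ has the separable complementation property. Consequently, if $X$ is weakly countably determined and contains a subspace isomorphic to $\ell_1$, then there is an equivalent norm on $X$ whose bidual norm on $X^{**}$ is octahedral. -/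

import Mathlib

open scoped ENNReal

noncomputable section

namespace BidualOctahedral

/-- The real sequence space `ℓ₁` with its usual norm. -/
abbrev EllOne : Type := lp (fun _ : ℕ => ℝ) 1

/-- `X` contains an isomorphic copy of `ℓ₁`: some linear subspace of `X` is linearly homeomorphic
to `ℓ₁`. -/
def ContainsEllOne (X : Type*) [NormedAddCommGroup X] [NormedSpace ℝ X] : Prop :=
  ∃ Y : Submodule ℝ X, Nonempty (EllOne ≃L[ℝ] Y)

/-- The separable complementation property: every separable subspace is contained in a separable
subspace that is the range of a bounded linear projection of `X`. -/
def SeparableComplementation (X : Type*) [NormedAddCommGroup X] [NormedSpace ℝ X] : Prop :=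
  ∀ Y : Submodule ℝ X, TopologicalSpace.IsSeparable (Y : Set X) →
    ∃ Z : Submodule ℝ X, TopologicalSpace.IsSeparable (Z : Set X) ∧ Z.ClosedComplemented ∧ Y ≤ Z

/-- `X` is weakly countably determined: there are countably many weak-star compact subsets `K n` of
the bidual such that every point of (the canonical image of) `X` is separated from every point of
the bidual outside `X` by some `K n` containing the former but not the latter. -/
def WeaklyCountablyDetermined (X : Type*) [NormedAddCommGroup X] [NormedSpace ℝ X] : Prop :=
  ∃ K : ℕ → Set (WeakDual ℝ (StrongDual ℝ X)), (∀ n, IsCompact (K n)) ∧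
    ∀ (x : X) (u : StrongDual ℝ (StrongDual ℝ X)),
      u ∉ Set.range (NormedSpace.inclusionInDoubleDual ℝ X) →
      ∃ n, StrongDual.toWeakDual (NormedSpace.inclusionInDoubleDual ℝ X x) ∈ K n ∧
        StrongDual.toWeakDual u ∉ K n

/-- `p` is a norm on `X` equivalent to the given one (the lower bound makes the seminorm `p`
definite). -/
def IsEquivalentNorm {X : Type*} [NormedAddCommGroup X] [NormedSpace ℝ X]
    (p : Seminorm ℝ X) : Prop :=
  ∃ c C : ℝ, 0 < c ∧ 0 < C ∧ ∀ x : X, c * ‖x‖ ≤ p x ∧ p x ≤ C * ‖x‖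

/-- The dual norm `f ↦ sup {|f x| : p x ≤ 1}` of a norm `p`. It is only used for norms `p`
equivalent to the given norm, so the supremum is that of a nonempty bounded set. -/
def dualNorm {E : Type*} [NormedAddCommGroup E] [NormedSpace ℝ E] (p : E → ℝ) :
    StrongDual ℝ E → ℝ :=
  fun f => sSup {t : ℝ | ∃ x : E, p x ≤ 1 ∧ t = |f x|}

/-- The bidual norm of `p`, on the bidual of the space: the dual norm of the dual norm of `p`.
(Equivalent norms have the same continuous functionals, so the bidual is the same vector space.) -/
def bidualNorm {E : Type*} [NormedAddCommGroup E] [NormedSpace ℝ E] (p : E → ℝ) :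
    StrongDual ℝ (StrongDual ℝ E) → ℝ :=
  dualNorm (dualNorm p)

/-- The norm `q` on `E` is octahedral: for every finite-dimensional subspace `F` and every `ε > 0`
there is `y` with `q y = 1` and `q (x + y) ≥ (1 - ε) (q x + q y)` for all `x ∈ F`. -/
def IsOctahedral {E : Type*} [AddCommGroup E] [Module ℝ E] (q : E → ℝ) : Prop :=
  ∀ F : Submodule ℝ E, FiniteDimensional ℝ F → ∀ ε : ℝ, 0 < ε →
    ∃ y : E, q y = 1 ∧ ∀ x ∈ F, (1 - ε) * (q x + q y) ≤ q (x + y)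

/-- `X` has an equivalent norm whose bidual norm is octahedral. -/
def HasBidualOctahedralRenorming (X : Type*) [NormedAddCommGroup X] [NormedSpace ℝ X] : Prop :=
  ∃ p : Seminorm ℝ X, IsEquivalentNorm p ∧ IsOctahedral (bidualNorm p)

end BidualOctahedral

end

/-!
Let `X` contain `ℓ₁` with unit vectors `e n`. Hahn–Banach extensions `g σ` of the sign functionals
of `ℓ₁` give an operator `x ↦ (σ ↦ g σ x)` into `ℓ∞` over all sequences of signs. It is smoothed by
averaging over independent biased signs: the smoothed operator `T` still sends `e n` to the `n`-th
sign, and by a variance estimate the sum of the changes of `T x` over `n` signs is `O(√n)`. The norm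
`‖x‖_{X/Y} + ‖T x‖`, with `Y` the copy of `ℓ₁`, is equivalent to the given one. A functional in its
dual unit ball is `h + ν ∘ T` with `h` vanishing on `Y` and `ν` a mean. Setting the `n`-th sign to
`1` before applying `ν` turns it into a functional in the ball with value `1` at `e n`, and the
`O(√n)` bound forces these functionals to converge weakly to the original one. Hence
`‖u + e n‖ → ‖u‖ + 1` for all `u` in the bidual, and a compactness argument makes the bidual norm
octahedral.

If the weak-star compact sets `K i` determine `X`, close a countable set off under finite spans and
under approximation, on finitely many norming functionals, of the points of each finite
intersection of the `K i` and a ball. For `x` in `X` this gives a sequence in the countable set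
which converges to `x` on its norming functionals and eventually lies in each `K i` containing `x`;
as its weak-star cluster points lie in the same `K i`, they belong to `X`. Sending `x` to such a
cluster point is a projection of norm one.
-/

noncomputable section

open Filter Topology
open scoped lp

namespace BidualOctahedral

section BoundedFunctions

variable {X ι κ : Type*} [NormedAddCommGroup X] [NormedSpace ℝ X]

/-- The bounded operator into `ℓ∞` whose coordinates are the members of a bounded family of
functionals. -/
def operatorOfFamily (g : ι → StrongDual ℝ X) (C : ℝ) (hg : ∀ i, ‖g i‖ ≤ C) :
    X →L[ℝ] ℓ^∞(ι, ℝ) :=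
  LinearMap.mkContinuous
    { toFun := fun x => ⟨fun i => g i x, memℓp_infty ⟨C * ‖x‖, by
        rintro _ ⟨i, rfl⟩
        exact (g i).le_of_opNorm_le (hg i) x⟩⟩
      map_add' := fun x y => lp.ext (funext fun i => map_add (g i) x y)
      map_smul' := fun a x => lp.ext (funext fun i => map_smul (g i) a x) }
    (max C 0) fun x => lp.norm_le_of_forall_le (by positivity) fun i =>
      (g i).le_of_opNorm_le ((hg i).trans (le_max_left C 0)) x

/-- Composition with `φ : ι → κ` as an operator `ℓ∞(κ) → ℓ∞(ι)`. -/
def pullback (φ : ι → κ) : ℓ^∞(κ, ℝ) →L[ℝ] ℓ^∞(ι, ℝ) :=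
  operatorOfFamily (fun i => lp.evalCLM ℝ _ ∞ (φ i)) 1 fun _ =>
    ContinuousLinearMap.opNorm_le_bound _ zero_le_one fun F =>
      (lp.norm_apply_le_norm ENNReal.top_ne_zero F _).trans_eq (one_mul ‖F‖).symm

@[simp]
theorem pullback_apply (φ : ι → κ) (F : ℓ^∞(κ, ℝ)) (i : ι) : pullback φ F i = F (φ i) := rfl

theorem norm_pullback_apply_le (φ : ι → κ) (F : ℓ^∞(κ, ℝ)) : ‖pullback φ F‖ ≤ ‖F‖ :=
  lp.norm_le_of_forall_le (norm_nonneg F) fun _ => lp.norm_apply_le_norm ENNReal.top_ne_zero F _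

theorem apply_le_norm (F : ℓ^∞(ι, ℝ)) (i : ι) : F i ≤ ‖F‖ :=
  (le_abs_self _).trans (lp.norm_apply_le_norm ENNReal.top_ne_zero F i)

/-- A mean on `ℓ∞(ι)`: a functional dominated by the supremum. -/
structure IsMean (ν : StrongDual ℝ ℓ^∞(ι, ℝ)) : Prop where
  le_of_le : ∀ (F : ℓ^∞(ι, ℝ)) (c : ℝ), (∀ i, F i ≤ c) → ν F ≤ c

namespace IsMean

variable {ν : StrongDual ℝ ℓ^∞(ι, ℝ)}

theorem le_map_of_le (hν : IsMean ν) {F : ℓ^∞(ι, ℝ)} {c : ℝ} (h : ∀ i, c ≤ F i) : c ≤ ν F := by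
  have := hν.le_of_le (-F) (-c) fun i => neg_le_neg (h i)
  rwa [map_neg, neg_le_neg_iff] at this

theorem map_eq_of_forall_eq (hν : IsMean ν) {F : ℓ^∞(ι, ℝ)} {c : ℝ} (h : ∀ i, F i = c) :
    ν F = c :=
  (hν.le_of_le F c fun i => (h i).le).antisymm (hν.le_map_of_le fun i => (h i).ge)

theorem abs_le_norm (hν : IsMean ν) (F : ℓ^∞(ι, ℝ)) : |ν F| ≤ ‖F‖ :=
  abs_le.2 ⟨hν.le_map_of_le fun i => (abs_le.1 (lp.norm_apply_le_norm ENNReal.top_ne_zero F i)).1,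
    hν.le_of_le F _ (apply_le_norm F)⟩

theorem norm_le_one (hν : IsMean ν) : ‖ν‖ ≤ 1 :=
  ν.opNorm_le_bound zero_le_one fun F => by simpa using hν.abs_le_norm F

theorem comp_pullback (hν : IsMean ν) (φ : ι → κ) : IsMean (ν.comp (pullback φ)) where
  le_of_le _ c hc := hν.le_of_le _ c fun i => hc (φ i)

theorem sq_map_mul_le (hν : IsMean ν) (F G : ℓ^∞(ι, ℝ)) :
    ν (F * G) ^ 2 ≤ ν (F * F) * ν (G * G) := by
  have hpos : ∀ t : ℝ, 0 ≤ ν (F * F) * (t * t) + 2 * ν (F * G) * t + ν (G * G) := fun t => by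
    have h := hν.le_map_of_le (F := (t • F + G) * (t • F + G)) (c := 0) fun i =>
      mul_self_nonneg ((t • F + G : ℓ^∞(ι, ℝ)) i)
    have hexpand : (t • F + G) * (t • F + G) = (t * t) • (F * F) + (2 * t) • (F * G) + G * G := by
      ext i
      simp only [lp.infty_coeFn_mul, lp.coeFn_add, lp.coeFn_smul, Pi.mul_apply, Pi.add_apply,
        Pi.smul_apply, smul_eq_mul]
      ring
    simp only [hexpand, map_add, map_smul, smul_eq_mul] at h
    linarith
  have := discrim_le_zero hpos
  rw [discrim] at this
  linarith

theorem abs_map_mul_le (hν : IsMean ν) (F G : ℓ^∞(ι, ℝ)) :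
    |ν (F * G)| ≤ ‖F‖ * √(ν (G * G)) := by
  have hF : ν (F * F) ≤ ‖F‖ ^ 2 := hν.le_of_le _ _ fun i => by
    have := lp.norm_apply_le_norm ENNReal.top_ne_zero F i
    rw [lp.infty_coeFn_mul, Pi.mul_apply, ← sq, ← sq_abs]
    gcongr
    exact this
  have hG : 0 ≤ ν (G * G) := hν.le_map_of_le fun i => mul_self_nonneg (G i)
  refine abs_le_of_sq_le_sq ?_ (by positivity)
  rw [mul_pow, Real.sq_sqrt hG]
  exact (hν.sq_map_mul_le F G).trans (by gcongr)

theorem exists_tendsto {α : Type*} (l : Ultrafilter α) {ν : α → StrongDual ℝ ℓ^∞(ι, ℝ)}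
    (hν : ∀ a, IsMean (ν a)) :
    ∃ μ : StrongDual ℝ ℓ^∞(ι, ℝ), IsMean μ ∧ ∀ F, Tendsto (fun a => ν a F) l (𝓝 (μ F)) := by
  have hball : ∀ᶠ a in l, StrongDual.toWeakDual (ν a) ∈
      WeakDual.toStrongDual ⁻¹' Metric.closedBall (0 : StrongDual ℝ ℓ^∞(ι, ℝ)) 1 :=
    Eventually.of_forall fun a => by simpa using (hν a).norm_le_one
  obtain ⟨μ, -, hμ⟩ := (WeakDual.isCompact_closedBall (𝕜 := ℝ) _ 1).ultrafilter_le_nhds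
    (l.map fun a => StrongDual.toWeakDual (ν a)) (tendsto_principal.2 hball)
  have hlim : ∀ F, Tendsto (fun a => ν a F) l (𝓝 (WeakDual.toStrongDual μ F)) := fun F =>
    ((WeakDual.eval_continuous F).tendsto μ).comp hμ
  exact ⟨WeakDual.toStrongDual μ, ⟨fun F c hc =>
    le_of_tendsto (hlim F) (Eventually.of_forall fun a => (hν a).le_of_le F c hc)⟩, hlim⟩

end IsMean

theorem isMean_evalCLM (i : ι) : IsMean (lp.evalCLM ℝ (fun _ : ι => ℝ) ∞ i) where
  le_of_le _ _ h := h i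

end BoundedFunctions

section BiasedSigns

/-- Sequences of signs. They index the coordinates of two copies of `ℓ∞`: one in which they are
random sequences, and one in which they are the biases of random sequences. -/
abbrev SignSeq : Type := ℕ → ℤˣ

theorem norm_intCast_units (u : ℤˣ) : ‖((u : ℤ) : ℝ)‖ = 1 := by
  rw [Int.norm_cast_real, Int.norm_coe_units]

/-- The value of the `n`-th sign, as a bounded function of the sequence of signs. -/
def coordSign (n : ℕ) : ℓ^∞(SignSeq, ℝ) :=
  ⟨fun σ => (σ n : ℤ), memℓp_infty ⟨1, by
    rintro _ ⟨σ, rfl⟩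
    exact (norm_intCast_units (σ n)).le⟩⟩

@[simp]
theorem coordSign_apply (n : ℕ) (σ : SignSeq) : coordSign n σ = (σ n : ℤ) := rfl

/-- The operator that sets the `n`-th sign to `t`. -/
def setSign (n : ℕ) (t : ℤˣ) : ℓ^∞(SignSeq, ℝ) →L[ℝ] ℓ^∞(SignSeq, ℝ) :=
  pullback fun σ => Function.update σ n t

@[simp]
theorem setSign_apply (n : ℕ) (t : ℤˣ) (F : ℓ^∞(SignSeq, ℝ)) (σ : SignSeq) :
    setSign n t F σ = F (Function.update σ n t) := rfl

/-- The operator that reverses the `n`-th sign. -/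
def flipSign (n : ℕ) : ℓ^∞(SignSeq, ℝ) →L[ℝ] ℓ^∞(SignSeq, ℝ) :=
  pullback fun σ => Function.update σ n (-σ n)

@[simp]
theorem flipSign_apply (n : ℕ) (F : ℓ^∞(SignSeq, ℝ)) (σ : SignSeq) :
    flipSign n F σ = F (Function.update σ n (-σ n)) := rfl

/-- The conditional expectation that draws the `n`-th sign anew, positive with odds three to
one. -/
def biasedAverage (n : ℕ) : ℓ^∞(SignSeq, ℝ) →L[ℝ] ℓ^∞(SignSeq, ℝ) :=
  (3 / 4 : ℝ) • setSign n 1 + (1 / 4 : ℝ) • setSign n (-1)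

theorem biasedAverage_apply (n : ℕ) (F : ℓ^∞(SignSeq, ℝ)) (σ : SignSeq) :
    biasedAverage n F σ =
      3 / 4 * F (Function.update σ n 1) + 1 / 4 * F (Function.update σ n (-1)) := rfl

theorem biasedAverage_biasedAverage (n : ℕ) (F : ℓ^∞(SignSeq, ℝ)) :
    biasedAverage n (biasedAverage n F) = biasedAverage n F := by
  ext σ
  simp only [biasedAverage_apply, Function.update_idem]
  ring

theorem biasedAverage_comm {n m : ℕ} (h : n ≠ m) (F : ℓ^∞(SignSeq, ℝ)) :
    biasedAverage n (biasedAverage m F) = biasedAverage m (biasedAverage n F) := by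
  ext σ
  simp only [biasedAverage_apply, Function.update_comm h]
  ring

theorem IsMean.comp_biasedAverage {ν : StrongDual ℝ ℓ^∞(SignSeq, ℝ)} (hν : IsMean ν) (n : ℕ) :
    IsMean (ν.comp (biasedAverage n)) where
  le_of_le F c hc := hν.le_of_le _ c fun σ => (biasedAverage_apply n F σ).trans_le <| by
    linarith [hc (Function.update σ n 1), hc (Function.update σ n (-1))]

/-- The expectation over `N` independent signs, each positive with odds three to one and followed
by positive signs. -/
def finiteBiasedMean : ℕ → StrongDual ℝ ℓ^∞(SignSeq, ℝ)
  | 0 => lp.evalCLM ℝ _ ∞ 1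
  | N + 1 => (finiteBiasedMean N).comp (biasedAverage N)

theorem isMean_finiteBiasedMean (N : ℕ) : IsMean (finiteBiasedMean N) := by
  induction N with
  | zero => exact isMean_evalCLM 1
  | succ N ih => exact ih.comp_biasedAverage N

theorem finiteBiasedMean_biasedAverage {n N : ℕ} (h : n < N) (F : ℓ^∞(SignSeq, ℝ)) :
    finiteBiasedMean N (biasedAverage n F) = finiteBiasedMean N F := by
  induction N, h using Nat.le_induction generalizing F with
  | base => exact congrArg (finiteBiasedMean n) (biasedAverage_biasedAverage n F)
  | succ N hN ih =>
    change finiteBiasedMean N (biasedAverage N (biasedAverage n F)) =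
      finiteBiasedMean N (biasedAverage N F)
    rw [biasedAverage_comm (Nat.lt_of_succ_le hN).ne', ih]

/-- A mean under which the signs are independent and each is positive with odds three to one. -/
structure IsBiasedMean (ν : StrongDual ℝ ℓ^∞(SignSeq, ℝ)) : Prop extends IsMean ν where
  map_biasedAverage : ∀ n F, ν (biasedAverage n F) = ν F

theorem exists_isBiasedMean : ∃ ν, IsBiasedMean ν := by
  obtain ⟨ν, hν, hlim⟩ := IsMean.exists_tendsto (hyperfilter ℕ) isMean_finiteBiasedMean
  refine ⟨ν, hν, fun n F => tendsto_nhds_unique (hlim _) ((hlim F).congr' ?_)⟩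
  filter_upwards [Nat.hyperfilter_le_atTop (eventually_gt_atTop n)] with N hN
  exact (finiteBiasedMean_biasedAverage hN F).symm

/-- The density, relative to a biased mean, by which the mean changes when the `n`-th sign is
reversed, i.e. `(1/4) / (3/4) - 1` at the sign `1` and `(3/4) / (1/4) - 1` at the sign `-1`. -/
def flipDensity (n : ℕ) : ℓ^∞(SignSeq, ℝ) := (2 / 3 : ℝ) • 1 - (4 / 3 : ℝ) • coordSign n

theorem flipDensity_apply (n : ℕ) (σ : SignSeq) :
    flipDensity n σ = 2 / 3 - 4 / 3 * (σ n : ℤ) := by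
  change 2 / 3 * 1 - 4 / 3 * coordSign n σ = _
  rw [mul_one, coordSign_apply]

theorem biasedAverage_flipSign (n : ℕ) (F : ℓ^∞(SignSeq, ℝ)) :
    biasedAverage n (flipSign n F) = biasedAverage n (F + F * flipDensity n) := by
  ext σ
  simp only [biasedAverage_apply, flipSign_apply, flipDensity_apply, lp.coeFn_add, Pi.add_apply,
    lp.infty_coeFn_mul, Pi.mul_apply, Function.update_idem, Function.update_self, neg_neg]
  push_cast
  ring

namespace IsBiasedMean

variable {ν : StrongDual ℝ ℓ^∞(SignSeq, ℝ)}

theorem map_coordSign (hν : IsBiasedMean ν) (n : ℕ) : ν (coordSign n) = 1 / 2 := by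
  rw [← hν.map_biasedAverage n]
  refine hν.map_eq_of_forall_eq fun σ => ?_
  norm_num [biasedAverage_apply]

theorem map_flipSign (hν : IsBiasedMean ν) (n : ℕ) (F : ℓ^∞(SignSeq, ℝ)) :
    ν (flipSign n F) = ν F + ν (F * flipDensity n) := by
  rw [← hν.map_biasedAverage n, biasedAverage_flipSign, hν.map_biasedAverage, map_add]

theorem map_flipDensity_mul (hν : IsBiasedMean ν) (n m : ℕ) :
    ν (flipDensity n * flipDensity m) = if m = n then 4 / 3 else 0 := by
  rw [← hν.map_biasedAverage n]
  refine hν.map_eq_of_forall_eq fun σ => ?_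
  simp only [biasedAverage_apply, lp.infty_coeFn_mul, Pi.mul_apply, flipDensity_apply]
  split_ifs with h
  · norm_num [h]
  · simp only [Function.update_self, Function.update_of_ne h]
    push_cast
    ring

theorem abs_sum_flipSign_sub_le (hν : IsBiasedMean ν) (F : ℓ^∞(SignSeq, ℝ)) (J : Finset ℕ) :
    |∑ n ∈ J, (ν (flipSign n F) - ν F)| ≤ 2 * ‖F‖ * √J.card := by
  set D := ∑ n ∈ J, flipDensity n
  have hsum : ∑ n ∈ J, (ν (flipSign n F) - ν F) = ν (F * D) := by
    simp only [hν.map_flipSign, add_sub_cancel_left, D, Finset.mul_sum, map_sum]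
  have hvar : ν (D * D) = 4 / 3 * J.card := by
    simp only [D, Finset.sum_mul_sum, map_sum, hν.map_flipDensity_mul, Finset.sum_ite_eq',
      Finset.sum_ite_mem, Finset.inter_self, Finset.sum_const, nsmul_eq_mul, mul_comm]
  calc |∑ n ∈ J, (ν (flipSign n F) - ν F)| ≤ ‖F‖ * √(ν (D * D)) := hsum ▸ hν.abs_map_mul_le F D
    _ ≤ ‖F‖ * √(2 ^ 2 * J.card) := by
      rw [hvar]
      gcongr
      norm_num
    _ = 2 * ‖F‖ * √J.card := by
      rw [Real.sqrt_mul (by positivity), Real.sqrt_sq (by positivity)]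
      ring

end IsBiasedMean

/-- The smoothing operator of a biased mean: the value of `smoothing ν F` at `b` is the expectation
of `F` over independent signs that agree with those of `b` with odds three to one. -/
def smoothing (ν : StrongDual ℝ ℓ^∞(SignSeq, ℝ)) (hν : IsMean ν) :
    ℓ^∞(SignSeq, ℝ) →L[ℝ] ℓ^∞(SignSeq, ℝ) :=
  operatorOfFamily (fun b => ν.comp (pullback (b * ·))) 1 fun _ => (hν.comp_pullback _).norm_le_one

section

variable {ν : StrongDual ℝ ℓ^∞(SignSeq, ℝ)}

theorem smoothing_apply (hν : IsMean ν) (F : ℓ^∞(SignSeq, ℝ)) (b : SignSeq) :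
    smoothing ν hν F b = ν (pullback (b * ·) F) := rfl

theorem smoothing_coordSign (hν : IsBiasedMean ν) (n : ℕ) (b : SignSeq) :
    smoothing ν hν.toIsMean (coordSign n) b = (b n : ℤ) / 2 := by
  have : pullback (b * ·) (coordSign n) = ((b n : ℤ) : ℝ) • coordSign n := by
    ext σ
    simp
  rw [smoothing_apply, this, map_smul, hν.map_coordSign, smul_eq_mul, mul_one_div]

theorem setSign_smoothing_sub_apply (hν : IsMean ν) (n : ℕ) (t : ℤˣ)
    (F : ℓ^∞(SignSeq, ℝ)) (b : SignSeq) :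
    (setSign n t (smoothing ν hν F) - smoothing ν hν F) b =
      if b n = t then 0 else ν (flipSign n (pullback (b * ·) F)) - ν (pullback (b * ·) F) := by
  rw [lp.coeFn_sub, Pi.sub_apply, setSign_apply]
  split_ifs with h
  · rw [← h, Function.update_eq_self, sub_self]
  · have ht : t = -b n := by
      rcases Int.units_eq_one_or t with rfl | rfl <;>
        rcases Int.units_eq_one_or (b n) with hb | hb <;> simp_all
    have hpull : pullback (Function.update b n t * ·) F = flipSign n (pullback (b * ·) F) := by
      ext σ
      refine congrArg F (funext fun k => ?_)
      rcases eq_or_ne k n with rfl | hk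
      · simp [ht]
      · simp [hk]
    rw [smoothing_apply, smoothing_apply, hpull]

theorem norm_sum_setSign_smoothing_sub_le (hν : IsBiasedMean ν) (t : ℤˣ) (F : ℓ^∞(SignSeq, ℝ))
    (J : Finset ℕ) :
    ‖∑ n ∈ J, (setSign n t (smoothing ν hν.toIsMean F) - smoothing ν hν.toIsMean F)‖ ≤
      2 * ‖F‖ * √J.card := by
  refine lp.norm_le_of_forall_le (by positivity) fun b => ?_
  calc ‖(∑ n ∈ J, (setSign n t (smoothing ν hν.toIsMean F) - smoothing ν hν.toIsMean F)) b‖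
      = |∑ n ∈ J with b n ≠ t,
          (ν (flipSign n (pullback (b * ·) F)) - ν (pullback (b * ·) F))| := by
        simp only [lp.coeFn_sum, Finset.sum_apply, setSign_smoothing_sub_apply, Finset.sum_filter,
          ite_not, Real.norm_eq_abs]
    _ ≤ 2 * ‖pullback (b * ·) F‖ * √(J.filter (b · ≠ t)).card := hν.abs_sum_flipSign_sub_le _ _
    _ ≤ 2 * ‖F‖ * √J.card := by
        gcongr
        · exact norm_pullback_apply_le _ F
        · exact Finset.filter_subset _ _

end

end BiasedSigns

section Sublinear

/-- Sublinear functionals, the majorants in the Hahn–Banach theorem. -/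
structure IsSublinear {V : Type*} [AddCommGroup V] [Module ℝ V] (N : V → ℝ) : Prop where
  map_smul : ∀ c : ℝ, 0 < c → ∀ x, N (c • x) = c * N x
  map_add_le : ∀ x y, N (x + y) ≤ N x + N y

variable {V W ι : Type*} [AddCommGroup V] [Module ℝ V] [AddCommGroup W] [Module ℝ W]

theorem isSublinear_seminorm (p : Seminorm ℝ V) : IsSublinear p where
  map_smul c hc x := by rw [map_smul_eq_mul, Real.norm_of_nonneg hc.le]
  map_add_le := map_add_le_add p

theorem IsSublinear.map_zero {N : V → ℝ} (hN : IsSublinear N) : N 0 = 0 := by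
  have := hN.map_smul 2 two_pos 0
  rw [smul_zero] at this
  linarith

theorem IsSublinear.exists_eq_add_comp {N₁ : V → ℝ} {N₂ : W → ℝ} (h₁ : IsSublinear N₁)
    (h₂ : IsSublinear N₂) (Φ : V →ₗ[ℝ] W) (f : V →ₗ[ℝ] ℝ) (hf : ∀ x, f x ≤ N₁ x + N₂ (Φ x)) :
    ∃ (h : V →ₗ[ℝ] ℝ) (ν : W →ₗ[ℝ] ℝ), (∀ x, h x ≤ N₁ x) ∧ (∀ y, ν y ≤ N₂ y) ∧
      ∀ x, f x = h x + ν (Φ x) := by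
  let fGraph : V × W →ₗ.[ℝ] ℝ := ⟨Φ.graph, f ∘ₗ LinearMap.fst ℝ V W ∘ₗ Φ.graph.subtype⟩
  obtain ⟨G, hG, hGN⟩ := exists_extension_of_le_sublinear fGraph (fun z => N₁ z.1 + N₂ z.2)
    (fun c hc z => by
      rw [Prod.smul_fst, Prod.smul_snd, h₁.map_smul c hc, h₂.map_smul c hc, mul_add])
    (fun z w => (add_le_add (h₁.map_add_le _ _) (h₂.map_add_le _ _)).trans_eq
      (add_add_add_comm _ _ _ _))
    (by
      rintro ⟨⟨x, y⟩, hy⟩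
      obtain rfl : y = Φ x := hy
      exact hf x)
  refine ⟨G ∘ₗ LinearMap.inl ℝ V W, G ∘ₗ LinearMap.inr ℝ V W, fun x => ?_, fun y => ?_,
    fun x => ?_⟩
  · simpa [h₂.map_zero] using hGN (x, 0)
  · simpa [h₁.map_zero] using hGN (0, y)
  · have : G (x, Φ x) = f x := hG ⟨(x, Φ x), rfl⟩
    simp [← this, ← map_add]

theorem bddAbove_range_apply (F : ℓ^∞(ι, ℝ)) : BddAbove (Set.range F) :=
  ⟨‖F‖, by
    rintro _ ⟨i, rfl⟩
    exact apply_le_norm F i⟩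

theorem isSublinear_iSup [Nonempty ι] : IsSublinear fun F : ℓ^∞(ι, ℝ) => ⨆ i, F i where
  map_smul _ hc F := (Real.mul_iSup_of_nonneg hc.le F).symm
  map_add_le F G := ciSup_le fun i =>
    add_le_add (le_ciSup (bddAbove_range_apply F) i) (le_ciSup (bddAbove_range_apply G) i)

theorem exists_isMean_of_le_iSup [Nonempty ι] (μ : ℓ^∞(ι, ℝ) →ₗ[ℝ] ℝ) (hμ : ∀ F, μ F ≤ ⨆ i, F i) :
    ∃ ν : StrongDual ℝ ℓ^∞(ι, ℝ), IsMean ν ∧ ∀ F, ν F = μ F := by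
  have hle : ∀ F, μ F ≤ ‖F‖ := fun F => (hμ F).trans (ciSup_le (apply_le_norm F))
  have hnorm : ∀ F, ‖μ F‖ ≤ 1 * ‖F‖ := fun F => by
    rw [one_mul]
    exact abs_le'.2 ⟨hle F, by simpa using hle (-F)⟩
  exact ⟨μ.mkContinuous 1 hnorm, ⟨fun F c hc => (hμ F).trans (ciSup_le hc)⟩, fun F => rfl⟩

end Sublinear

section SignFunctionals

/-- A sequence of signs, as an element of `ℓ∞`. -/
def signVector (σ : SignSeq) : ℓ^∞(ℕ, ℝ) :=
  ⟨fun n => (σ n : ℤ), memℓp_infty ⟨1, by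
    rintro _ ⟨n, rfl⟩
    exact (norm_intCast_units (σ n)).le⟩⟩

/-- The functional on `ℓ₁` whose values at the unit vectors are the given signs. -/
def signFunctional (σ : SignSeq) : StrongDual ℝ EllOne :=
  lp.dualPairing ∞ 1 (fun _ => ContinuousLinearMap.mul ℝ ℝ)
    (fun _ => ContinuousLinearMap.opNorm_mul_le ℝ ℝ) (signVector σ) (K := 1)

theorem signFunctional_apply (σ : SignSeq) (c : EllOne) :
    signFunctional σ c = ∑' n, (σ n : ℤ) * c n := rfl

theorem norm_signFunctional_le_one (σ : SignSeq) : ‖signFunctional σ‖ ≤ 1 := by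
  have hσ : ‖signVector σ‖ ≤ 1 :=
    lp.norm_le_of_forall_le zero_le_one fun n => (norm_intCast_units (σ n)).le
  have hpairing := lp.norm_dualPairing (p := ∞) (q := 1) (K := 1)
    (fun _ : ℕ => ContinuousLinearMap.mul ℝ ℝ) fun _ => ContinuousLinearMap.opNorm_mul_le ℝ ℝ
  exact (ContinuousLinearMap.le_of_opNorm_le_of_le _ hpairing hσ).trans_eq (by simp)

theorem signFunctional_single (σ : SignSeq) (n : ℕ) :
    signFunctional σ (lp.single 1 n 1) = (σ n : ℤ) := by
  rw [signFunctional_apply, tsum_eq_single n fun m hm => by simp [hm]]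
  simp

theorem exists_signFunctional_eq_norm (c : EllOne) : ∃ σ, signFunctional σ c = ‖c‖ := by
  refine ⟨fun n => if 0 ≤ c n then 1 else -1, ?_⟩
  simp only [signFunctional_apply, lp.norm_eq_tsum_rpow (p := 1) (by simp) c, ENNReal.toReal_one,
    Real.rpow_one, div_one]
  refine tsum_congr fun n => ?_
  split_ifs with h
  · simp [abs_of_nonneg h]
  · simp [abs_of_neg (not_le.1 h)]

end SignFunctionals

section SignOperators

variable {X : Type*} [NormedAddCommGroup X] [NormedSpace ℝ X] {e : ℕ → X}
  {T : X →L[ℝ] ℓ^∞(SignSeq, ℝ)}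

/-- An operator `T` that represents each `e n` as the `n`-th sign and every `x` as an odd function
of the signs, such that the total influence of `n` signs is at most of the order of `√n`. -/
structure IsSmoothSignOperator (e : ℕ → X) (T : X →L[ℝ] ℓ^∞(SignSeq, ℝ)) : Prop where
  map_basis : ∀ n, T (e n) = coordSign n
  odd : ∀ x b, T x (-b) = -T x b
  smooth : ∃ K : ℝ, ∀ J : Finset ℕ, ‖∑ n ∈ J, ((setSign n 1).comp T - T)‖ ≤ K * √J.card

/-- The operator that reverses all the signs. -/
def flipAll : ℓ^∞(SignSeq, ℝ) →L[ℝ] ℓ^∞(SignSeq, ℝ) := pullback Neg.neg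

theorem setSign_flipAll (n : ℕ) (t : ℤˣ) (F : ℓ^∞(SignSeq, ℝ)) :
    setSign n t (flipAll F) = flipAll (setSign n (-t) F) := by
  ext b
  refine congrArg F (funext fun k => ?_)
  rcases eq_or_ne k n with rfl | hk
  · simp
  · simp [hk]

theorem exists_isSmoothSignOperator {g : SignSeq → StrongDual ℝ X} {C : ℝ} (hg : ∀ σ, ‖g σ‖ ≤ C)
    (he : ∀ σ n, g σ (e n) = (σ n : ℤ)) : ∃ T, IsSmoothSignOperator e T := by
  obtain ⟨ν, hν⟩ := exists_isBiasedMean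
  let S := operatorOfFamily g C hg
  let U := smoothing ν hν.toIsMean
  refine ⟨(U - flipAll.comp U).comp S, fun n => ?_, fun x b => ?_, 4 * ‖S‖, fun J =>
    ContinuousLinearMap.opNorm_le_bound _ (by positivity) fun x => ?_⟩
  · have hS : S (e n) = coordSign n := lp.ext (funext fun σ => he σ n)
    ext b
    change U (S (e n)) b - U (S (e n)) (-b) = coordSign n b
    rw [hS, smoothing_coordSign hν, smoothing_coordSign hν, coordSign_apply, Pi.neg_apply,
      Units.val_neg]
    push_cast
    ring
  · change U (S x) (-b) - U (S x) (- -b) = -(U (S x) b - U (S x) (-b))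
    rw [neg_neg, neg_sub]
  · have hsum : (∑ n ∈ J, ((setSign n 1).comp ((U - flipAll.comp U).comp S) -
        (U - flipAll.comp U).comp S)) x =
        ∑ n ∈ J, (setSign n 1 (U (S x)) - U (S x)) -
          flipAll (∑ n ∈ J, (setSign n (-1) (U (S x)) - U (S x))) := by
      simp only [sum_apply, sub_apply, ContinuousLinearMap.comp_apply, map_sum, map_sub,
        setSign_flipAll, ← Finset.sum_sub_distrib]
      exact Finset.sum_congr rfl fun n _ => by abel
    have hinfluence := fun t => norm_sum_setSign_smoothing_sub_le hν t (S x) J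
    rw [hsum]
    calc ‖∑ n ∈ J, (setSign n 1 (U (S x)) - U (S x)) -
          flipAll (∑ n ∈ J, (setSign n (-1) (U (S x)) - U (S x)))‖
        ≤ 2 * ‖S x‖ * √J.card + 2 * ‖S x‖ * √J.card :=
          (norm_sub_le _ _).trans (add_le_add (hinfluence 1)
            ((norm_pullback_apply_le _ _).trans (hinfluence (-1))))
      _ = 4 * ‖S x‖ * √J.card := by ring
      _ ≤ 4 * (‖S‖ * ‖x‖) * √J.card := by
          gcongr
          exact S.le_opNorm x
      _ = 4 * ‖S‖ * √J.card * ‖x‖ := by ring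

theorem exists_isSmoothSignOperator_of_equiv {Y : Submodule ℝ X} (J : EllOne ≃L[ℝ] Y) :
    ∃ T, IsSmoothSignOperator (fun n => (J (lp.single 1 n 1) : X)) T := by
  choose g hg hnorm using fun σ =>
    exists_extension_norm_eq Y ((signFunctional σ).comp (J.symm : Y →L[ℝ] EllOne))
  refine exists_isSmoothSignOperator (g := g) (C := ‖(J.symm : Y →L[ℝ] EllOne)‖) (fun σ => ?_)
    fun σ n => ?_
  · calc ‖g σ‖ ≤ ‖signFunctional σ‖ * ‖(J.symm : Y →L[ℝ] EllOne)‖ :=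
          (hnorm σ).trans_le (ContinuousLinearMap.opNorm_comp_le _ _)
      _ ≤ ‖(J.symm : Y →L[ℝ] EllOne)‖ :=
          mul_le_of_le_one_left (ContinuousLinearMap.opNorm_nonneg _) (norm_signFunctional_le_one σ)
  · rw [hg, ContinuousLinearMap.comp_apply, ContinuousLinearEquiv.coe_coe,
      ContinuousLinearEquiv.symm_apply_apply, signFunctional_single]

namespace IsSmoothSignOperator

theorem apply_eq_signFunctional {J : EllOne →L[ℝ] X}
    (hT : IsSmoothSignOperator (fun n => J (lp.single 1 n 1)) T) (c : EllOne) (b : SignSeq) :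
    T (J c) b = signFunctional b c := by
  have : (lp.evalCLM ℝ (fun _ : SignSeq => ℝ) ∞ b).comp (T.comp J) = signFunctional b := by
    refine lp.ext_continuousLinearMap ENNReal.one_ne_top fun n => ContinuousLinearMap.ext_ring ?_
    change T (J (lp.single 1 n 1)) b = signFunctional b (lp.single 1 n 1)
    rw [hT.map_basis, coordSign_apply, signFunctional_single]
  exact DFunLike.congr_fun this c

theorem norm_le_norm_apply {J : EllOne →L[ℝ] X}
    (hT : IsSmoothSignOperator (fun n => J (lp.single 1 n 1)) T) (c : EllOne) :
    ‖c‖ ≤ ‖T (J c)‖ := by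
  obtain ⟨b, hb⟩ := exists_signFunctional_eq_norm c
  rw [← hb, ← hT.apply_eq_signFunctional]
  exact apply_le_norm _ b

theorem norm_apply_eq_iSup (hT : IsSmoothSignOperator e T) (x : X) : ‖T x‖ = ⨆ b, T x b := by
  refine (lp.norm_eq_ciSup (T x)).trans (le_antisymm (ciSup_le fun b => abs_le'.2 ⟨?_, ?_⟩)
    (ciSup_mono (lp.memℓp (T x)).bddAbove fun b => le_abs_self _))
  · exact le_ciSup (bddAbove_range_apply (T x)) b
  · rw [← hT.odd x b]
    exact le_ciSup (bddAbove_range_apply (T x)) (-b)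

end IsSmoothSignOperator

end SignOperators

section Renorming

variable {X W : Type*} [NormedAddCommGroup X] [NormedSpace ℝ X] [SeminormedAddCommGroup W]
  [NormedSpace ℝ W]

/-- The seminorm `‖x‖_{X/Y} + ‖T x‖`, which is a norm if `T` is bounded below on `Y`. -/
def quotientRenorming (Y : Submodule ℝ X) (T : X →L[ℝ] W) : Seminorm ℝ X :=
  (normSeminorm ℝ (X ⧸ Y)).comp Y.mkQ + (normSeminorm ℝ W).comp (T : X →ₗ[ℝ] W)

theorem quotientRenorming_apply (Y : Submodule ℝ X) (T : X →L[ℝ] W) (x : X) :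
    quotientRenorming Y T x = ‖Y.mkQ x‖ + ‖T x‖ := rfl

theorem isEquivalentNorm_quotientRenorming {Y : Submodule ℝ X} {T : X →L[ℝ] W} {A : ℝ}
    (hA : 0 ≤ A) (hT : ∀ y ∈ Y, ‖y‖ ≤ A * ‖T y‖) : IsEquivalentNorm (quotientRenorming Y T) := by
  have hB : 0 < 1 + A * ‖T‖ := by positivity
  have hlower : ∀ x, ‖x‖ ≤ (1 + A * ‖T‖) * ‖Y.mkQ x‖ + A * ‖T x‖ := fun x => by
    have hdist : (‖x‖ - A * ‖T x‖) / (1 + A * ‖T‖) ≤ Metric.infDist x Y := by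
      refine (Metric.le_infDist ⟨0, Y.zero_mem⟩).2 fun y hy => (div_le_iff₀' hB).2 ?_
      have hTy : ‖T y‖ ≤ ‖T x‖ + ‖T‖ * ‖x - y‖ := by
        have := norm_sub_le (T x) (T (x - y))
        rw [← map_sub, sub_sub_cancel] at this
        exact this.trans (add_le_add_right (T.le_opNorm _) _)
      have hy' := (hT y hy).trans (mul_le_mul_of_nonneg_left hTy hA)
      have hx : ‖x‖ ≤ ‖x - y‖ + ‖y‖ := by simpa using norm_add_le (x - y) y
      rw [dist_eq_norm]
      linarith
    have hmk : ‖Y.mkQ x‖ = Metric.infDist x Y := QuotientAddGroup.norm_mk x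
    rw [div_le_iff₀' hB, ← hmk] at hdist
    linarith
  refine ⟨(1 + A * ‖T‖ + A)⁻¹, 1 + ‖T‖, by positivity, by positivity, fun x => ⟨?_, ?_⟩⟩
  · rw [inv_mul_le_iff₀ (by positivity), quotientRenorming_apply]
    nlinarith [hlower x, norm_nonneg (Y.mkQ x), norm_nonneg (T x)]
  · rw [quotientRenorming_apply, add_mul, one_mul]
    exact add_le_add (Submodule.Quotient.norm_mk_le Y x) (T.le_opNorm x)

end Renorming

section OctahedralSequence

variable {X : Type*} [NormedAddCommGroup X] [NormedSpace ℝ X]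

theorem tendsto_apply_cofinite_of_norm_sum_le {ι : Type*} {v : ι → X} {K : ℝ}
    (hv : ∀ J : Finset ι, ‖∑ n ∈ J, v n‖ ≤ K * √J.card) (u : StrongDual ℝ X) :
    Tendsto (fun n => u (v n)) cofinite (𝓝 0) := by
  have hfin : ∀ (w : StrongDual ℝ X) (δ : ℝ), 0 < δ → {n | δ ≤ w (v n)}.Finite := fun w δ hδ => by
    by_contra hinf
    obtain ⟨m, hm⟩ := exists_nat_gt ((‖w‖ * K / δ) ^ 2)
    obtain ⟨J, hJ, hcard⟩ := Set.Infinite.exists_subset_card_eq hinf m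
    have hle : m * δ ≤ ‖w‖ * K * √m := calc
      m * δ ≤ ∑ n ∈ J, w (v n) := by
        rw [← hcard, ← nsmul_eq_mul]
        exact Finset.card_nsmul_le_sum J _ _ fun n hn => hJ hn
      _ ≤ ‖w‖ * ‖∑ n ∈ J, v n‖ := by
        rw [← map_sum]
        exact (le_abs_self _).trans (w.le_opNorm _)
      _ ≤ ‖w‖ * K * √m := by
        rw [mul_assoc, ← hcard]
        gcongr
        exact hv J
    have hsqrt : ‖w‖ * K / δ < √m := Real.lt_sqrt_of_sq_lt hm
    have hpos : 0 < (m : ℝ) := (sq_nonneg _).trans_lt hm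
    rw [div_lt_iff₀ hδ] at hsqrt
    nlinarith [Real.mul_self_sqrt hpos.le, Real.sqrt_pos.2 hpos]
  refine Metric.tendsto_nhds.2 fun δ hδ => ?_
  filter_upwards [(hfin u δ hδ).eventually_cofinite_notMem,
    (hfin (-u) δ hδ).eventually_cofinite_notMem] with n h₁ h₂
  rw [Real.dist_0_eq_abs, abs_lt]
  exact ⟨neg_lt.1 (not_le.1 h₂), not_le.1 h₁⟩

/-- A sequence in the unit ball of `p` on which the dual unit ball is asymptotically free: every
functional `f` in that ball is the weak limit of functionals `φ n` in it that attain the value `1`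
at `y n`. -/
structure IsOctahedralSequence (p : Seminorm ℝ X) (y : ℕ → X) : Prop where
  le_one : ∀ n, p (y n) ≤ 1
  exists_tendsto : ∀ f : StrongDual ℝ X, (∀ x, f x ≤ p x) →
    ∃ φ : ℕ → StrongDual ℝ X, (∀ n x, φ n x ≤ p x) ∧ (∀ n, φ n (y n) = 1) ∧
      ∀ u : StrongDual ℝ (StrongDual ℝ X), Tendsto (fun n => u (φ n)) atTop (𝓝 (u f))

namespace IsSmoothSignOperator

variable {e : ℕ → X} {T : X →L[ℝ] ℓ^∞(SignSeq, ℝ)}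

theorem exists_eq_add_mean (hT : IsSmoothSignOperator e T) {Y : Submodule ℝ X}
    {f : StrongDual ℝ X} (hf : ∀ x, f x ≤ quotientRenorming Y T x) :
    ∃ (h : X →ₗ[ℝ] ℝ) (ν : StrongDual ℝ ℓ^∞(SignSeq, ℝ)), (∀ x, h x ≤ ‖Y.mkQ x‖) ∧
      IsMean ν ∧ ∀ x, f x = h x + ν (T x) := by
  obtain ⟨h, μ, hh, hμ, hfμ⟩ :=
    (isSublinear_seminorm ((normSeminorm ℝ (X ⧸ Y)).comp Y.mkQ)).exists_eq_add_comp
      isSublinear_iSup (T : X →ₗ[ℝ] ℓ^∞(SignSeq, ℝ)) (f : X →ₗ[ℝ] ℝ)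
      fun x => (hf x).trans_eq (congrArg _ (hT.norm_apply_eq_iSup x))
  obtain ⟨ν, hν, hνμ⟩ := exists_isMean_of_le_iSup μ hμ
  exact ⟨h, ν, hh, hν, fun x => (hfμ x).trans (congrArg _ (hνμ (T x)).symm)⟩

theorem isOctahedralSequence (hT : IsSmoothSignOperator e T) {Y : Submodule ℝ X}
    (hY : ∀ n, e n ∈ Y) : IsOctahedralSequence (quotientRenorming Y T) e where
  le_one n := by
    rw [quotientRenorming_apply, hT.map_basis, Y.mkQ_apply,
      (Submodule.Quotient.mk_eq_zero Y).2 (hY n), norm_zero, zero_add]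
    exact lp.norm_le_of_forall_le zero_le_one fun σ => (norm_intCast_units (σ n)).le
  exists_tendsto f hf := by
    obtain ⟨h, ν, hh, hν, hfν⟩ := hT.exists_eq_add_mean hf
    obtain ⟨K, hK⟩ := hT.smooth
    have hφ : ∀ n x, (f + ν.comp ((setSign n 1).comp T - T)) x = h x + ν (setSign n 1 (T x)) :=
      fun n x => by
        simp only [add_apply, sub_apply, ContinuousLinearMap.comp_apply, map_sub, hfν]
        ring
    refine ⟨fun n => f + ν.comp ((setSign n 1).comp T - T), fun n x => ?_, fun n => ?_, fun u => ?_⟩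
    · rw [hφ]
      exact add_le_add (hh x) <| (le_abs_self _).trans <|
        (hν.abs_le_norm _).trans (norm_pullback_apply_le _ _)
    · have hhY : h (e n) = 0 := by
        have hquot : ∀ y ∈ Y, h y ≤ 0 := fun y hy =>
          (hh y).trans_eq (by simp [(Submodule.Quotient.mk_eq_zero Y).2 hy])
        refine (hquot _ (hY n)).antisymm ?_
        simpa using hquot _ (Y.neg_mem (hY n))
      rw [hφ, hhY, hT.map_basis, zero_add]
      exact hν.map_eq_of_forall_eq fun σ => by simp
    · have hsum : ∀ J : Finset ℕ,
          ‖∑ n ∈ J, ν.comp ((setSign n 1).comp T - T)‖ ≤ K * √J.card := fun J => by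
        have := (ν.opNorm_comp_le (∑ n ∈ J, ((setSign n 1).comp T - T))).trans
          (mul_le_of_le_one_left (norm_nonneg _) hν.norm_le_one)
        rw [ContinuousLinearMap.comp_finsetSum] at this
        exact this.trans (hK J)
      have hlim := tendsto_apply_cofinite_of_norm_sum_le hsum u
      rw [Nat.cofinite_eq_atTop] at hlim
      simpa using hlim.const_add (u f)

end IsSmoothSignOperator

theorem ContainsEllOne.exists_isOctahedralSequence (hX : ContainsEllOne X) :
    ∃ (p : Seminorm ℝ X) (y : ℕ → X), IsEquivalentNorm p ∧ IsOctahedralSequence p y := by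
  obtain ⟨Y, ⟨J⟩⟩ := hX
  obtain ⟨T, hT⟩ := exists_isSmoothSignOperator_of_equiv J
  let toX : EllOne →L[ℝ] X := Y.subtypeL.comp (J : EllOne →L[ℝ] Y)
  refine ⟨quotientRenorming Y T, fun n => toX (lp.single 1 n 1),
    isEquivalentNorm_quotientRenorming (norm_nonneg toX) fun y hy => ?_,
    hT.isOctahedralSequence fun n => (J _).2⟩
  obtain ⟨c, hc⟩ := J.surjective ⟨y, hy⟩
  obtain rfl : toX c = y := congrArg Subtype.val hc
  exact (toX.le_opNorm c).trans
    (mul_le_mul_of_nonneg_left (hT.norm_le_norm_apply (J := toX) c) (norm_nonneg _))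

end OctahedralSequence

section DualNorm

variable {E : Type*} [NormedAddCommGroup E] [NormedSpace ℝ E] {p : Seminorm ℝ E}

theorem dualNorm_nonneg (p : E → ℝ) (f : StrongDual ℝ E) : 0 ≤ dualNorm p f :=
  Real.sSup_nonneg fun _ ⟨_, _, ht⟩ => ht ▸ abs_nonneg _

namespace IsEquivalentNorm

theorem abs_le_dualNorm (hp : IsEquivalentNorm p) (f : StrongDual ℝ E) {x : E} (hx : p x ≤ 1) :
    |f x| ≤ dualNorm p f := by
  obtain ⟨c, _, hc, _, hpc⟩ := hp
  refine le_csSup ⟨‖f‖ * c⁻¹, ?_⟩ ⟨x, hx, rfl⟩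
  rintro _ ⟨z, hz, rfl⟩
  have hzc : ‖z‖ ≤ c⁻¹ := by
    rw [← mul_one c⁻¹, le_inv_mul_iff₀ hc]
    exact (hpc z).1.trans hz
  exact f.le_of_opNorm_le_of_le le_rfl hzc

theorem dualNorm_le_iff (hp : IsEquivalentNorm p) {f : StrongDual ℝ E} {a : ℝ} (ha : 0 ≤ a) :
    dualNorm p f ≤ a ↔ ∀ x, f x ≤ a * p x := by
  refine ⟨fun h x => ?_, fun h => csSup_le ⟨_, 0, by simp, rfl⟩ ?_⟩
  · rcases eq_or_ne x 0 with rfl | hx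
    · simp
    have hpx : 0 < p x := by
      obtain ⟨c, _, hc, _, hpc⟩ := hp
      exact (mul_pos hc (norm_pos_iff.2 hx)).trans_le (hpc x).1
    have hunit : p ((p x)⁻¹ • x) ≤ 1 := by
      rw [map_smul_eq_mul, norm_inv, Real.norm_of_nonneg hpx.le, inv_mul_cancel₀ hpx.ne']
    have := (le_abs_self _).trans ((hp.abs_le_dualNorm f hunit).trans h)
    rwa [map_smul, smul_eq_mul, inv_mul_le_iff₀' hpx] at this
  · rintro _ ⟨x, hx, rfl⟩
    have hle : ∀ z, p z ≤ 1 → f z ≤ a := fun z hz => (h z).trans (mul_le_of_le_one_right ha hz)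
    refine abs_le'.2 ⟨hle x hx, ?_⟩
    simpa using hle (-x) (by rwa [map_neg_eq_map])

theorem apply_le_dualNorm_mul (hp : IsEquivalentNorm p) (f : StrongDual ℝ E) (x : E) :
    f x ≤ dualNorm p f * p x :=
  (hp.dualNorm_le_iff (dualNorm_nonneg p f)).1 le_rfl x

theorem exists_lt_apply_of_lt_dualNorm (f : StrongDual ℝ E) {r : ℝ} (hr : r < dualNorm p f) :
    ∃ x, p x ≤ 1 ∧ r < f x := by
  obtain ⟨_, ⟨x, hx, rfl⟩, hrx⟩ := exists_lt_of_lt_csSup (by exact ⟨_, 0, by simp, rfl⟩) hr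
  rcases lt_abs.1 hrx with h | h
  · exact ⟨x, hx, h⟩
  · exact ⟨-x, by rwa [map_neg_eq_map], by rwa [map_neg]⟩

/-- The dual norm of an equivalent norm, as a seminorm. -/
def dualSeminorm (hp : IsEquivalentNorm p) : Seminorm ℝ (StrongDual ℝ E) :=
  Seminorm.ofSMulLE (dualNorm p)
    (((hp.dualNorm_le_iff le_rfl).2 fun x => by simp).antisymm (dualNorm_nonneg p 0))
    (fun f g => (hp.dualNorm_le_iff (add_nonneg (dualNorm_nonneg p f) (dualNorm_nonneg p g))).2
      fun x => (add_le_add (hp.apply_le_dualNorm_mul f x) (hp.apply_le_dualNorm_mul g x)).trans_eq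
        (add_mul _ _ _).symm)
    fun r f => (hp.dualNorm_le_iff (mul_nonneg (norm_nonneg r) (dualNorm_nonneg p f))).2 fun x => by
      have := hp.apply_le_dualNorm_mul f (r • x)
      rw [map_smul, map_smul_eq_mul] at this
      exact this.trans_eq (by ring)

theorem isEquivalentNorm_dualSeminorm (hp : IsEquivalentNorm p) :
    IsEquivalentNorm hp.dualSeminorm := by
  obtain ⟨c, C, hc, hC, hpc⟩ := id hp
  refine ⟨C⁻¹, c⁻¹, by positivity, by positivity, fun f => ⟨?_, ?_⟩⟩
  · rw [inv_mul_le_iff₀ hC]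
    refine f.opNorm_le_bound (mul_nonneg hC.le (apply_nonneg _ _)) fun x => ?_
    have hle : ∀ z, f z ≤ C * dualNorm p f * ‖z‖ := fun z => calc
      f z ≤ dualNorm p f * p z := hp.apply_le_dualNorm_mul f z
      _ ≤ dualNorm p f * (C * ‖z‖) := mul_le_mul_of_nonneg_left (hpc z).2 (dualNorm_nonneg p f)
      _ = C * dualNorm p f * ‖z‖ := by ring
    have hneg := hle (-x)
    rw [map_neg, norm_neg] at hneg
    exact abs_le'.2 ⟨hle x, hneg⟩
  · refine (hp.dualNorm_le_iff (by positivity)).2 fun x => ?_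
    calc f x ≤ ‖f‖ * ‖x‖ := (le_abs_self _).trans (f.le_opNorm x)
      _ = c⁻¹ * ‖f‖ * (c * ‖x‖) := by field_simp
      _ ≤ c⁻¹ * ‖f‖ * p x := mul_le_mul_of_nonneg_left (hpc x).1 (by positivity)

theorem isOctahedral_of_eventually (hp : IsEquivalentNorm p) {ι : Type*} {l : Filter ι} [l.NeBot]
    {y : ι → E} (hy : ∀ i, p (y i) = 1)
    (hlim : ∀ u, ∀ δ > 0, ∀ᶠ i in l, p u + 1 - δ ≤ p (u + y i)) : IsOctahedral p := by
  obtain ⟨c, C, hc, hC, hpc⟩ := hp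
  intro F hF ε hε
  obtain ⟨t, htfin, ht⟩ := Metric.totallyBounded_iff.1
    (isCompact_closedBall (0 : F) (2 / ε / c)).totallyBounded (ε / 3 / C) (by positivity)
  obtain ⟨i, hi⟩ := ((eventually_all_finite htfin).2 fun v _ =>
    hlim v (ε / 3) (by positivity)).exists
  refine ⟨y i, hy i, fun x hx => ?_⟩
  have hpx : 0 ≤ p x := apply_nonneg p x
  rw [hy]
  rcases le_or_gt (2 / ε) (p x) with hlarge | hsmall
  · have hsub : p x - p (y i) ≤ p (x + y i) := by
      simpa using map_sub_le_add p (x + y i) (y i)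
    rw [div_le_iff₀ hε] at hlarge
    rw [hy] at hsub
    linarith
  · have hmem : (⟨x, hx⟩ : F) ∈ Metric.closedBall (0 : F) (2 / ε / c) := by
      rw [mem_closedBall_zero_iff, le_div_iff₀' hc]
      exact (hpc x).1.trans hsmall.le
    obtain ⟨v, hv, hxv⟩ := Set.mem_iUnion₂.1 (ht hmem)
    have hclose : p (x - v) ≤ ε / 3 := by
      have hnorm : ‖x - v‖ < ε / 3 / C := by simpa [dist_eq_norm] using hxv
      exact (hpc _).2.trans ((lt_div_iff₀' hC).1 hnorm).le
    have hx_le : p x ≤ p v + p (x - v) := by simpa using map_add_le_add p (v : E) (x - v)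
    have hv_le : p (v + y i) ≤ p (x + y i) + p (x - v) := by
      simpa [add_comm (y i)] using map_sub_le_add p (x + y i) (x - v)
    nlinarith [hi v hv]

end IsEquivalentNorm

theorem IsOctahedralSequence.isOctahedral_bidualNorm {y : ℕ → E} (hy : IsOctahedralSequence p y)
    (hp : IsEquivalentNorm p) : IsOctahedral (bidualNorm p) := by
  have hq := hp.isEquivalentNorm_dualSeminorm
  let z : ℕ → StrongDual ℝ (StrongDual ℝ E) := fun n => NormedSpace.inclusionInDoubleDual ℝ E (y n)
  have hball : ∀ {f : StrongDual ℝ E}, (∀ x, f x ≤ p x) → dualNorm p f ≤ 1 := fun hf =>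
    (hp.dualNorm_le_iff zero_le_one).2 fun x => (hf x).trans_eq (one_mul _).symm
  have happly : ∀ (u : StrongDual ℝ (StrongDual ℝ E)) {f : StrongDual ℝ E}, (∀ x, f x ≤ p x) →
      u f ≤ bidualNorm p u := fun u f hf =>
    (hq.apply_le_dualNorm_mul u f).trans (mul_le_of_le_one_right (dualNorm_nonneg _ u) (hball hf))
  refine hq.isEquivalentNorm_dualSeminorm.isOctahedral_of_eventually (l := atTop) (y := z)
    (fun n => le_antisymm ?_ ?_) fun u δ hδ => ?_
  · refine (hq.dualNorm_le_iff zero_le_one).2 fun f => ?_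
    rw [one_mul]
    exact (hp.apply_le_dualNorm_mul f (y n)).trans
      (mul_le_of_le_one_right (dualNorm_nonneg p f) (hy.le_one n))
  · obtain ⟨φ, hφ, hφy, -⟩ := hy.exists_tendsto 0 fun x => apply_nonneg p x
    exact (hφy n).symm.trans_le (happly (z n) (hφ n))
  · obtain ⟨f, hf, hfu⟩ := IsEquivalentNorm.exists_lt_apply_of_lt_dualNorm (p := hp.dualSeminorm) u
      (sub_lt_self (bidualNorm p u) hδ)
    obtain ⟨φ, hφ, hφy, hlim⟩ := hy.exists_tendsto f fun x =>
      ((hp.dualNorm_le_iff zero_le_one).1 hf x).trans_eq (one_mul _)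
    filter_upwards [(hlim u).eventually (lt_mem_nhds hfu)] with n hn
    calc bidualNorm p u + 1 - δ ≤ u (φ n) + φ n (y n) := by
          rw [hφy]
          linarith
      _ = (u + z n) (φ n) := rfl
      _ ≤ bidualNorm p (u + z n) := happly _ (hφ n)

theorem ContainsEllOne.hasBidualOctahedralRenorming (hE : ContainsEllOne E) :
    HasBidualOctahedralRenorming E := by
  obtain ⟨p, y, hp, hy⟩ := hE.exists_isOctahedralSequence
  exact ⟨p, hp, hy.isOctahedral_bidualNorm hp⟩

end DualNorm

section ClosingOff

theorem exists_countable_closed_superset {α : Type*} {c : Finset α → Set α}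
    (hc : ∀ G, (c G).Countable) {A₀ : Set α} (hA₀ : A₀.Countable) :
    ∃ A, A.Countable ∧ A₀ ⊆ A ∧ ∀ G : Finset α, (G : Set α) ⊆ A → c G ⊆ A := by
  let B : ℕ → Set α := Nat.rec A₀ fun _ S => S ∪ ⋃ G ∈ {G : Finset α | (G : Set α) ⊆ S}, c G
  have hmono : Monotone B := monotone_nat_of_le_succ fun n => Set.subset_union_left
  have hB : ∀ n, (B n).Countable := fun n => by
    induction n with
    | zero => exact hA₀
    | succ n ih =>
      have hfinite : {G : Finset α | (G : Set α) ⊆ B n}.Countable :=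
        ((Set.countable_ofPred_finite_subset ih).preimage Finset.coe_injective).mono
          fun G hG => And.intro G.finite_toSet hG
      exact ih.union (hfinite.biUnion fun G _ => hc G)
  refine ⟨⋃ n, B n, Set.countable_iUnion hB, Set.subset_iUnion B 0, fun G hG => ?_⟩
  obtain ⟨n, hn⟩ := hmono.directed_le.exists_mem_subset_of_finset_subset_biUnion hG
  exact (Set.subset_biUnion_of_mem (u := c) hn).trans
    (Set.subset_union_right.trans (Set.subset_iUnion B (n + 1)))

theorem exists_countable_subset_image_subset_closure {α β : Type*} [TopologicalSpace β]
    [SecondCountableTopology β] (Φ : α → β) (W : Set α) :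
    ∃ D ⊆ W, D.Countable ∧ Φ '' W ⊆ closure (Φ '' D) := by
  let _ : TopologicalSpace W := .induced (fun w : W => Φ w) inferInstance
  have : SecondCountableTopology W := TopologicalSpace.secondCountableTopology_induced _ _ _
  obtain ⟨s, hs, hdense⟩ := TopologicalSpace.exists_countable_dense W
  refine ⟨(↑) '' s, Subtype.coe_image_subset W s, hs.image _, ?_⟩
  rintro _ ⟨x, hx, rfl⟩
  rw [Set.image_image]
  exact closure_induced.1 (hdense ⟨x, hx⟩)

theorem exists_countable_forall_exists_tendsto {α ι : Type*} [Countable ι] (ev : α → α → ℝ)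
    (W : ι → Set α) {c : Finset α → Set α} (hc : ∀ G, (c G).Countable) {A₀ : Set α}
    (hA₀ : A₀.Countable) :
    ∃ A, A.Countable ∧ A₀ ⊆ A ∧ (∀ G : Finset α, (G : Set α) ⊆ A → c G ⊆ A) ∧
      ∀ (j : ℕ → ι) (x : α), (∀ N, x ∈ W (j N)) → ∃ y : ℕ → α, (∀ N, y N ∈ A ∩ W (j N)) ∧
        ∀ a ∈ A, Tendsto (fun N => ev a (y N)) atTop (𝓝 (ev a x)) := by
  choose D hDW hD hdense using fun (G : Finset α) i =>
    exists_countable_subset_image_subset_closure (fun x (a : G) => ev a x) (W i)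
  obtain ⟨A, hA, hA₀A, hclosed⟩ := exists_countable_closed_superset
    (fun G => (hc G).union (Set.countable_iUnion (hD G))) hA₀
  have hAD : ∀ G : Finset α, (G : Set α) ⊆ A → ∀ i, D G i ⊆ A := fun G hG i =>
    (Set.subset_iUnion (D G) i).trans (Set.subset_union_right.trans (hclosed G hG))
  refine ⟨A, hA, hA₀A, fun G hG => Set.subset_union_left.trans (hclosed G hG), fun j x hx => ?_⟩
  let Ψ : α → A → ℝ := fun x a => ev a x
  have happrox : ∀ i, x ∈ W i → ∀ U ∈ 𝓝 (Ψ x), ∃ y ∈ A ∩ W i, Ψ y ∈ U := fun i hxi U hU => by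
    rw [nhds_pi, Filter.mem_pi] at hU
    obtain ⟨I, hI, t, ht, htU⟩ := hU
    let G : Finset α := hI.toFinset.map (Function.Embedding.subtype _)
    have hG : (G : Set α) ⊆ A := by simp [G]
    obtain ⟨_, hyt, y, hy, rfl⟩ := mem_closure_iff_nhds.1
      (hdense G i (Set.mem_image_of_mem _ hxi)) (Set.univ.pi fun a : G => t ⟨a, hG a.2⟩)
      (set_pi_mem_nhds Set.finite_univ fun a _ => ht ⟨a, hG a.2⟩)
    exact ⟨y, ⟨hAD G hG i hy, hDW G i hy⟩, htU fun a ha => hyt ⟨a, by simpa [G] using ha⟩ trivial⟩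
  have := hA.to_subtype
  obtain ⟨U, hU⟩ := (𝓝 (Ψ x)).exists_antitone_basis
  choose y hy hyU using fun N => happrox (j N) (hx N) (U N) (hU.mem N)
  exact ⟨y, hy, fun a ha => tendsto_pi_nhds.1 (hU.tendsto hyU) ⟨a, ha⟩⟩

end ClosingOff

section WeaklyCountablyDetermined

variable {X : Type*} [NormedAddCommGroup X] [NormedSpace ℝ X]

theorem closedComplemented_of_functionals {Z : Submodule ℝ X} {B : Set (StrongDual ℝ X)} {C : ℝ}
    (hnorm : ∀ x, ∀ z ∈ Z, (∀ f ∈ B, f z = f x) → ‖z‖ ≤ C * ‖x‖)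
    (hex : ∀ x, ∃ z ∈ Z, ∀ f ∈ B, f z = f x) : Z.ClosedComplemented := by
  choose P hPZ hP using hex
  have hunique : ∀ {x z}, z ∈ Z → (∀ f ∈ B, f z = f x) → P x = z := fun {x z} hz hzx => by
    have := hnorm 0 (P x - z) (Z.sub_mem (hPZ x) hz) fun f hf => by
      rw [map_sub, hP x f hf, hzx f hf, sub_self, map_zero]
    rw [norm_zero, mul_zero, norm_le_zero_iff] at this
    exact sub_eq_zero.1 this
  let L : X →ₗ[ℝ] Z :=
    { toFun := fun x => ⟨P x, hPZ x⟩
      map_add' := fun x y => Subtype.ext <| hunique (Z.add_mem (hPZ x) (hPZ y)) fun f hf => by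
        change f (P x + P y) = f (x + y)
        rw [map_add, map_add, hP x f hf, hP y f hf]
      map_smul' := fun a x => Subtype.ext <| hunique (Z.smul_mem a (hPZ x)) fun f hf => by
        change f (a • P x) = f (a • x)
        rw [map_smul, map_smul, hP x f hf] }
  exact ⟨L.mkContinuous C fun x => hnorm x (P x) (hPZ x) (hP x), fun z =>
    Subtype.ext (hunique z.2 fun _ _ => rfl)⟩

theorem norm_le_of_forall_norming_eq {n : X → StrongDual ℝ X} (hn : ∀ a, ‖n a‖ ≤ 1)
    (hna : ∀ a, n a a = ‖a‖) {A : Set X} {x z : X} (hz : z ∈ closure A)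
    (h : ∀ a ∈ A, n a z = n a x) : ‖z‖ ≤ ‖x‖ := by
  refine le_of_forall_pos_le_add fun δ hδ => ?_
  obtain ⟨a, ha, hza⟩ := Metric.mem_closure_iff.1 hz (δ / 2) (half_pos hδ)
  have hbound : ∀ w, n a w ≤ ‖w‖ := fun w =>
    (le_abs_self _).trans (((n a).le_of_opNorm_le (hn a) w).trans_eq (one_mul _))
  rw [dist_eq_norm] at hza
  calc ‖z‖ ≤ ‖z - a‖ + ‖a‖ := by simpa using norm_add_le (z - a) a
    _ = ‖z - a‖ + n a (a - z) + n a x := by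
      rw [map_sub, hna, h a ha]
      ring
    _ ≤ ‖z - a‖ + ‖a - z‖ + ‖x‖ := by
      gcongr
      exacts [hbound _, hbound _]
    _ ≤ ‖x‖ + δ := by
      rw [norm_sub_rev a z]
      linarith

open NormedSpace (inclusionInDoubleDual)

theorem exists_weak_limit {κ α : Type*} {K : κ → Set (WeakDual ℝ (StrongDual ℝ X))}
    (hK : ∀ i, IsCompact (K i)) {x : X}
    (hsep : ∀ u ∉ Set.range (inclusionInDoubleDual ℝ X), ∃ i,
      StrongDual.toWeakDual (inclusionInDoubleDual ℝ X x) ∈ K i ∧ StrongDual.toWeakDual u ∉ K i)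
    {l : Ultrafilter α} {y : α → X} {r : ℝ} (hr : ∀ a, ‖y a‖ ≤ r)
    (hy : ∀ i, StrongDual.toWeakDual (inclusionInDoubleDual ℝ X x) ∈ K i →
      ∀ᶠ a in l, StrongDual.toWeakDual (inclusionInDoubleDual ℝ X (y a)) ∈ K i) :
    ∃ w : X, ∀ f : StrongDual ℝ X, Tendsto (fun a => f (y a)) l (𝓝 (f w)) := by
  let toBidual : X → WeakDual ℝ (StrongDual ℝ X) := fun w =>
    StrongDual.toWeakDual (inclusionInDoubleDual ℝ X w)
  have hball : ∀ᶠ a in l, toBidual (y a) ∈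
      WeakDual.toStrongDual ⁻¹' Metric.closedBall (0 : StrongDual ℝ (StrongDual ℝ X)) r :=
    Eventually.of_forall fun a =>
      (mem_closedBall_zero_iff (E := StrongDual ℝ (StrongDual ℝ X))).2 <|
        (NormedSpace.double_dual_bound ℝ X (y a)).trans (hr a)
  obtain ⟨v, -, hv⟩ := (WeakDual.isCompact_closedBall (𝕜 := ℝ) _ r).ultrafilter_le_nhds
    (l.map fun a => toBidual (y a)) (tendsto_principal.2 hball)
  obtain ⟨w, hw⟩ : WeakDual.toStrongDual v ∈ Set.range (inclusionInDoubleDual ℝ X) := by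
    by_contra hnotin
    obtain ⟨i, hxi, hvi⟩ := hsep _ hnotin
    exact hvi ((hK i).isClosed.mem_of_tendsto hv (hy i hxi))
  refine ⟨w, fun f => ?_⟩
  have hlim : Tendsto (fun a => f (y a)) l (𝓝 (v f)) :=
    ((WeakDual.eval_continuous f).tendsto v).comp hv
  have hvw : v f = f w := (DFunLike.congr_fun hw f).symm
  rwa [hvw] at hlim

theorem mem_of_weak_limit {Z : Submodule ℝ X} (hZ : IsClosed (Z : Set X)) {α : Type*}
    {l : Filter α} [l.NeBot] {y : α → X} (hy : ∀ a, y a ∈ Z) {w : X}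
    (hlim : ∀ f : StrongDual ℝ X, Tendsto (fun a => f (y a)) l (𝓝 (f w))) : w ∈ Z := by
  by_contra hw
  obtain ⟨f, r, hfw, hfZ⟩ := geometric_hahn_banach_point_closed Z.convex hZ hw
  exact hfw.not_ge (ge_of_tendsto (hlim f) (Eventually.of_forall fun a => (hfZ _ (hy a)).le))

theorem span_subset_closure {A : Set X} {c : Finset X → Set X}
    (hc : ∀ G : Finset X, (Submodule.span ℝ (G : Set X) : Set X) ⊆ closure (c G))
    (hA : ∀ G : Finset X, (G : Set X) ⊆ A → c G ⊆ A) :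
    (Submodule.span ℝ A : Set X) ⊆ closure A := fun x hx => by
  obtain ⟨G, hG, hxG⟩ := Submodule.mem_span_finite_of_mem_span hx
  exact closure_mono (hA G hG) (hc G hxG)

theorem WeaklyCountablyDetermined.separableComplementation (hX : WeaklyCountablyDetermined X) :
    SeparableComplementation X := by
  rintro Y ⟨A₀, hA₀, hYA₀⟩
  obtain ⟨K, hK, hsep⟩ := hX
  choose n hn hna using fun x : X => exists_dual_vector'' ℝ x
  choose c hc hspan using fun G : Finset X =>
    (G.finite_toSet.isSeparable.span (R := ℝ) : TopologicalSpace.IsSeparable _)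
  let W : Finset ℕ × ℕ → Set X := fun j => {x | ‖x‖ ≤ j.2 ∧
    ∀ i ∈ j.1, StrongDual.toWeakDual (inclusionInDoubleDual ℝ X x) ∈ K i}
  obtain ⟨A, hA, hA₀A, hcA, hlim⟩ :=
    exists_countable_forall_exists_tendsto (fun a x => n a x) W hc hA₀
  let Z := (Submodule.span ℝ A).topologicalClosure
  have hZA : (Z : Set X) ⊆ closure A :=
    closure_minimal (span_subset_closure hspan hcA) isClosed_closure
  have hAZ : closure A ⊆ Z := closure_mono Submodule.subset_span
  refine ⟨Z, hA.isSeparable.closure.mono hZA,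
    closedComplemented_of_functionals (B := n '' A) (C := 1) ?_ fun x => ?_,
    hYA₀.trans ((closure_mono hA₀A).trans hAZ)⟩
  · intro x z hz hzx
    rw [one_mul]
    exact norm_le_of_forall_norming_eq hn hna (hZA hz) fun a ha => hzx _ ⟨a, ha, rfl⟩
  classical
  obtain ⟨m, hm⟩ := exists_nat_ge ‖x‖
  obtain ⟨y, hy, hyx⟩ := hlim (fun N => ({i ∈ Finset.range N |
    StrongDual.toWeakDual (inclusionInDoubleDual ℝ X x) ∈ K i}, m)) x
      fun N => ⟨hm, fun i hi => (Finset.mem_filter.1 hi).2⟩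
  obtain ⟨w, hw⟩ := exists_weak_limit (l := hyperfilter ℕ) (r := m) hK (hsep x)
    (fun N => (hy N).2.1) fun i hi => by
      filter_upwards [Nat.hyperfilter_le_atTop (eventually_gt_atTop i)] with N hN
      exact (hy N).2.2 i (Finset.mem_filter.2 ⟨Finset.mem_range.2 hN, hi⟩)
  refine ⟨w, mem_of_weak_limit (Submodule.isClosed_topologicalClosure _)
    (fun N => hAZ (subset_closure (hy N).1)) hw, ?_⟩
  rintro _ ⟨a, ha, rfl⟩
  exact tendsto_nhds_unique (hw (n a)) ((hyx a ha).mono_left Nat.hyperfilter_le_atTop)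

end WeaklyCountablyDetermined

end BidualOctahedral

end

theorem corollary4p3_general (X : Type*) [NormedAddCommGroup X] [NormedSpace ℝ X] :
    (BidualOctahedral.ContainsEllOne X → BidualOctahedral.HasBidualOctahedralRenorming X) ∧
    (BidualOctahedral.WeaklyCountablyDetermined X →
      BidualOctahedral.SeparableComplementation X) :=
  ⟨fun hX => hX.hasBidualOctahedralRenorming, fun hX => hX.separableComplementation⟩

theorem corollary4p3 (X : Type*) [NormedAddCommGroup X] [NormedSpace ℝ X] [CompleteSpace X] :
    (BidualOctahedral.SeparableComplementation X → BidualOctahedral.ContainsEllOne X →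
      BidualOctahedral.HasBidualOctahedralRenorming X) ∧
    (BidualOctahedral.WeaklyCountablyDetermined X →
      BidualOctahedral.SeparableComplementation X) ∧
    (BidualOctahedral.WeaklyCountablyDetermined X → BidualOctahedral.ContainsEllOne X →
      BidualOctahedral.HasBidualOctahedralRenorming X) :=
  have ⟨hrenorming, hcomplementation⟩ := corollary4p3_general X
  ⟨fun _ => hrenorming, hcomplementation, fun _ => hrenorming⟩
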